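/- Let $g$ be a rational map of the Riemann sphere $\widehat{\mathbb C}$ for which $\infty$ is a repelling fixed point. Let $n\ge 2$ and let $\gamma_1,\dots,\gamma_n$ be independent Jordan curves in $\widehat{\mathbb C}$: for $i\ne j$ the set $\gamma_i\cap\gamma_j$ is finite, and each $\widehat{\mathbb C}\setminus\gamma_k$ has a designated component $\mathrm{Int}(\gamma_k)$ such that $\mathrm{Int}(\gamma_1),\dots,\mathrm{Int}(\gamma_n)$ are pairwise disjoint. Let $\mathrm{Ext}(\gamma_k)$ be the other component of $\widehat{\mathbb C}\setminus\gamma_k$ and $A=\bigcap_{k=1}^n\mathrm{Ext}(\gamma_k)$. Suppose that 1. $\infty\in\gamma_1\cap\dots\cap\gamma_n$; 2. every fixed point of $g$ in $\mathbb C$ lies in $\mathrm{Int}(\gamma_1)\cup\dots\cup\mathrm{Int}(\gamma_n)$; 3. for every $k$, the number of poles of $g$ in $\overline{\mathrm{Ext}(\gamma_k)}\setminus\{\infty\}$ equals the number of fixed points of $g$ in that set, counted with multiplicity. Then the number of poles of $g$ in $\overline{A}\setminus\{\infty\}$, counted with multiplicity, is exactly $n-1$. Here the multiplicity of a fixed point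 $z_0\in\mathbb C$ is the order of vanishing of $g(z)-z$ at $z_0$. For the poles the assertion holds under each of the following two conventions. (i) Every pole $p\in\mathbb C$ is counted with its order $\operatorname{ord}(p)$ (the local degree of $g$ at $p$), on the curves too. (ii) A pole on a curve is counted on each side with a share of its order: let integers $1\le m_k(p)\le\operatorname{ord}(p)$ be given for all $k$ and all poles $p\in\gamma_k\cap\mathbb C$. In assumption 3 a pole $p\in\overline{\mathrm{Ext}(\gamma_k)}\setminus\{\infty\}$ is counted with multiplicity $m_k(p)$ if $p\in\gamma_k$ and $\operatorname{ord}(p)$ otherwise; the remaining share $\operatorname{ord}(p)-m_k(p)$ belongs to the interior side of $\gamma_k$. In the conclusion a pole $p\in\overline A\setminus\{\infty\}$ is counted with what is left after removing the shares of the interior sides, that is, with $\operatorname{ord}(p)-\sum_{k:\,p\in\gamma_k}\bigl(\operatorname{ord}(p)-m_k(p)\bigr)$. -/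

import Mathlib

noncomputable section

open scoped Classical in
/-- The self-map of the Riemann sphere `OnePoint ℂ` defined by a rational function `g = P / Q`
in lowest terms. -/
def sphereMap (g : RatFunc ℂ) (x : OnePoint ℂ) : OnePoint ℂ :=
  x.elim
    (if g.denom.natDegree < g.num.natDegree then OnePoint.infty
      else ((g.num.coeff g.denom.natDegree / g.denom.leadingCoeff : ℂ) : OnePoint ℂ))
    (fun z : ℂ => if g.denom.eval z = 0 then OnePoint.infty
      else ((g.num.eval z / g.denom.eval z : ℂ) : OnePoint ℂ))

open scoped Classical in
/-- The rational map near `∞`, read in the coordinate `w = 1 / z` (used when `∞` is fixed, so that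
`w = 0` is sent to `0`). -/
def chartAtInfty (g : RatFunc ℂ) (w : ℂ) : ℂ :=
  if w = 0 then 0 else (g.num.eval w⁻¹ / g.denom.eval w⁻¹)⁻¹

/-- `∞` is a repelling fixed point of `g`: it is fixed and its multiplier `μ`, the derivative at
`w = 0` in the coordinate `w = 1 / z`, has modulus greater than one. -/
def IsRepellingAtInfty (g : RatFunc ℂ) : Prop :=
  sphereMap g OnePoint.infty = OnePoint.infty ∧
    ∃ μ : ℂ, HasDerivAt (chartAtInfty g) μ 0 ∧ 1 < ‖μ‖

/-- A Jordan curve in the Riemann sphere: the image of a continuous injection of the circle. -/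
def IsJordanCurve (γ : Set (OnePoint ℂ)) : Prop :=
  ∃ f : Circle → OnePoint ℂ, Continuous f ∧ Function.Injective f ∧ Set.range f = γ

/-- `U` is a connected component of the set `S`. -/
def IsComponentOf (U S : Set (OnePoint ℂ)) : Prop :=
  ∃ x ∈ S, U = connectedComponentIn S x

/-- Independence of the Jordan curves `γ k`, with `I k` the component of the complement of `γ k`
that is designated as its interior part. -/
structure AreIndependent {n : ℕ} (γ I : Fin n → Set (OnePoint ℂ)) : Prop where
  two_le : 2 ≤ n
  jordan : ∀ k, IsJordanCurve (γ k)
  finite_inter : ∀ i j, i ≠ j → (γ i ∩ γ j).Finite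
  component : ∀ k, IsComponentOf (I k) (γ k)ᶜ
  disjoint : ∀ i j, i ≠ j → Disjoint (I i) (I j)

/-- The exterior part of a Jordan curve `γ` with interior part `I`: what remains of the complement
of `γ` when its component `I` is taken away (the other component). -/
def exteriorPart (γ I : Set (OnePoint ℂ)) : Set (OnePoint ℂ) := γᶜ \ I

/-- The common exterior `A(γ₁, …, γₙ)`, the intersection of the exterior parts. -/
def commonExterior {n : ℕ} (γ I : Fin n → Set (OnePoint ℂ)) : Set (OnePoint ℂ) :=
  ⋂ k, exteriorPart (γ k) (I k)

/-- The order of a point `p` of `ℂ` as a pole of `g`; it is the local degree of `g` at the pole. -/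
def poleOrder (g : RatFunc ℂ) (p : ℂ) : ℕ := g.denom.rootMultiplicity p

open scoped Classical in
/-- The poles of `g` in `S \ {∞}`. -/
def polesIn (g : RatFunc ℂ) (S : Set (OnePoint ℂ)) : Finset ℂ :=
  g.denom.roots.toFinset.filter (fun p : ℂ => (p : OnePoint ℂ) ∈ S)

/-- The number of poles of `g` in `S \ {∞}`, each counted with its order. -/
def poleCount (g : RatFunc ℂ) (S : Set (OnePoint ℂ)) : ℕ :=
  ∑ p ∈ polesIn g S, poleOrder g p

open scoped Classical in
/-- The number of fixed points of `g = P / Q` in `S \ {∞}`, each counted with the order of vanishing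
of `g z - z = (P z - z Q z) / Q z` there (a common zero of `P - z Q` and `Q` does not exist). -/
def fixedCount (g : RatFunc ℂ) (S : Set (OnePoint ℂ)) : ℕ :=
  ∑ z ∈ (g.num - Polynomial.X * g.denom).roots.toFinset.filter
      (fun z : ℂ => (z : OnePoint ℂ) ∈ S),
    (g.num - Polynomial.X * g.denom).rootMultiplicity z

open scoped Classical in
/-- The multiplicity of a pole `p` in a closed exterior part bounded by `γ`, where a pole on the
curve counts with the prescribed multiplicity `m p` and a pole off the curve with its order. -/
def exteriorMult (g : RatFunc ℂ) (γ : Set (OnePoint ℂ)) (m : ℂ → ℕ) (p : ℂ) : ℕ :=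
  if (p : OnePoint ℂ) ∈ γ then m p else poleOrder g p

open scoped Classical in
/-- The multiplicity of a pole `p` in the closed common exterior, when a pole `p` on `γ k` has the
multiplicity `m k p` on the exterior side of `γ k` and hence `poleOrder g p - m k p` on the interior
side: what is left of the order once the shares of the interior sides are taken away. -/
def commonMult (g : RatFunc ℂ) {n : ℕ} (γ : Fin n → Set (OnePoint ℂ)) (m : Fin n → ℂ → ℕ)
    (p : ℂ) : ℤ :=
  (poleOrder g p : ℤ) -
    ∑ k ∈ Finset.univ.filter (fun k => (p : OnePoint ℂ) ∈ γ k),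
      ((poleOrder g p : ℤ) - (m k p : ℤ))

end

/-! Write `g = P / Q` in lowest terms and `d = deg Q`, the number of finite poles. Since `∞` is
repelling, its multiplier is neither `0` nor `1`, which forces `P - z Q` to have degree `d + 1`:
there are `d + 1` finite fixed points (`IsRepellingAtInfty.natDegree_fixed`). The closed exteriors
are the complements of the `I k`, and the closure of the common exterior is the complement of `⋃ k,
I k`. Let `S k` be the total pole order on the interior side of `γ k`, shares on the curve included.
Assumption 3 says that `d - S k` fixed points lie outside `I k`. Each fixed point lies in exactly
one interior, so summing over `k` gives `n d - ∑ S k = (n - 1)(d + 1)`, that is, `d - ∑ S k = n -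
1`. The left side is the pole count in the closed common exterior. The closures need only a part of
the Jordan curve theorem: a Jordan curve has empty interior, and if its complement is disconnected,
every component accumulates on the whole curve. Both follow from continuous logarithms: a loop
winding once around `0` has none, whereas a circle with a point removed carries one. -/

open Topology Filter

/-! ### Continuous logarithms and winding -/

/-- A continuous function without zeros on a simply connected space has a continuous logarithm. -/
theorem exists_continuous_log {A : Type*} [TopologicalSpace A] [SimplyConnectedSpace A]
    [LocallyPathConnectedSpace A] {f : A → ℂ} (hf : Continuous f) (h0 : ∀ a, f a ≠ 0) :
    ∃ F : A → ℂ, Continuous F ∧ ∀ a, Complex.exp (F a) = f a := by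
  obtain ⟨a₀⟩ : Nonempty A := inferInstance
  obtain ⟨F, ⟨-, hF⟩, -⟩ := Complex.isCoveringMapOn_exp.existsUnique_continuousMap_lifts
    ⟨f, hf⟩ (a₀ := a₀) (Complex.exp_log (h0 a₀)) h0
  exact ⟨F, F.continuous, fun a => congrFun hF a⟩

/-- A continuous function on the plane that agrees with a nonconstant affine function near infinity
has a zero. -/
theorem exists_zero_of_affine_near_infinity {G : ℂ → ℂ} (hG : Continuous G) {a : ℂ} (ha : a ≠ 0)
    {R : ℝ} (hGR : ∀ w, R ≤ ‖w‖ → G w = a * w + 1) : ∃ w, G w = 0 := by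
  by_contra! h0
  obtain ⟨F, hF, hFG⟩ := exists_continuous_log hG h0
  -- The loop `c` solves `a * c t + 1 = r * exp (i t)`; this `r` gives `‖c t‖ ≥ (r - 1) / ‖a‖ =
  -- |R|`.
  set r : ℝ := ‖a‖ * |R| + 1 with hr
  have hrpos : 0 < r := by positivity
  set c : ℝ → ℂ := fun t => (r * Complex.exp (t * Complex.I) - 1) / a with hc
  have hcc : Continuous c := by fun_prop
  have hcR : ∀ t, R ≤ ‖c t‖ := by
    intro t
    have h1 : r - 1 ≤ ‖(r : ℂ) * Complex.exp (t * Complex.I) - 1‖ := by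
      have := norm_sub_norm_le ((r : ℂ) * Complex.exp (t * Complex.I)) 1
      simpa [Complex.norm_exp_ofReal_mul_I, abs_of_pos hrpos] using this
    rw [hc]
    simp only [norm_div]
    rw [le_div_iff₀ (norm_pos_iff.2 ha)]
    have := le_abs_self R
    have := norm_nonneg a
    nlinarith
  have hexp : ∀ t : ℝ, Complex.exp (F (c t)) = r * Complex.exp (t * Complex.I) := by
    intro t
    rw [hFG, hGR _ (hcR t), hc]
    field_simp
    ring
  -- By uniqueness of lifts the logarithm grows by `2 π i` along the closed loop `c`, which is
  -- absurd.
  have key := Complex.isCoveringMap_exp.eq_of_comp_eq (A := ℝ) (g₁ := fun t => F (c t))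
    (g₂ := fun t : ℝ => F (c 0) + t * Complex.I) (hF.comp hcc) (by fun_prop) (by
      funext t
      apply Subtype.ext
      simp only [Function.comp_apply, Complex.exp_add, hexp]
      simp) 0 (by simp)
  have h2 := congrFun key (2 * Real.pi)
  have h3 : c (2 * Real.pi) = c 0 := by
    simp [hc, Complex.exp_two_pi_mul_I]
  simp only [h3] at h2
  simp [Real.pi_ne_zero] at h2

/-- The coordinate of the sphere that has its zero at `p` and its pole at `q`, normalized at `∞`;
its value at `q` is meaningless. -/
noncomputable def crossRatio (p q : ℂ) (x : OnePoint ℂ) : ℂ :=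
  x.elim 1 (fun z => (z - p) / (z - q))

/-- The parametrization of the sphere without `q` by the plane that sends `0` to `∞`. -/
noncomputable def invertAt (q w : ℂ) : OnePoint ℂ :=
  open scoped Classical in if w = 0 then OnePoint.infty else ((q + w⁻¹ : ℂ) : OnePoint ℂ)

theorem continuousAt_crossRatio (p : ℂ) {q : ℂ} {x : OnePoint ℂ} (hx : x ≠ q) :
    ContinuousAt (crossRatio p q) x := by
  induction x using OnePoint.rec with
  | infty =>
    rw [OnePoint.continuousAt_infty', coclosedCompact_eq_cocompact,
      ← Metric.cobounded_eq_cocompact]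
    have h1 : Tendsto (fun z : ℂ => 1 + (q - p) * (z - q)⁻¹) (Bornology.cobounded ℂ) (𝓝 1) := by
      have h2 : Tendsto (fun z : ℂ => z - q) (Bornology.cobounded ℂ) (Bornology.cobounded ℂ) := by
        simp [sub_eq_add_neg]
      have h3 := ((tendsto_inv₀_cobounded (α := ℂ)).comp h2).const_mul (q - p)
      simpa using h3.const_add 1
    refine Tendsto.congr' ?_ h1
    have : ∀ᶠ z : ℂ in Bornology.cobounded ℂ, z ≠ q := by
      rw [Metric.cobounded_eq_cocompact]
      exact (isCompact_singleton (x := q)).compl_mem_cocompact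
    filter_upwards [this] with z hz
    have : z - q ≠ 0 := sub_ne_zero.2 hz
    simp only [crossRatio, Function.comp_apply, OnePoint.elim_some]
    field_simp
    ring
  | coe z =>
    rw [OnePoint.continuousAt_coe]
    have hz : z - q ≠ 0 := sub_ne_zero.2 fun h => hx (by rw [h])
    change ContinuousAt (fun z : ℂ => (z - p) / (z - q)) z
    fun_prop (disch := exact hz)

theorem crossRatio_ne_zero {p q : ℂ} {x : OnePoint ℂ} (hp : x ≠ p) (hq : x ≠ q) :
    crossRatio p q x ≠ 0 := by
  induction x using OnePoint.rec with
  | infty => simp [crossRatio]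
  | coe z =>
    simp only [ne_eq, OnePoint.coe_eq_coe] at hp hq
    simp [crossRatio, sub_eq_zero, hp, hq]

/-- In the coordinate `w = 1 / (z - q)` the pole `q` moves to infinity, so the cross ratio becomes
affine. -/
theorem crossRatio_invertAt (p q w : ℂ) : crossRatio p q (invertAt q w) = (q - p) * w + 1 := by
  by_cases hw : w = 0
  · simp [crossRatio, invertAt, hw]
  · simp [crossRatio, invertAt, hw]
    field_simp
    ring

theorem continuous_invertAt (q : ℂ) : Continuous (invertAt q) := by
  rw [continuous_iff_continuousAt]
  intro w
  by_cases hw : w = 0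
  · subst hw
    rw [continuousAt_iff_punctured_nhds]
    have h1 : Tendsto (fun w : ℂ => q + w⁻¹) (𝓝[≠] 0) (Bornology.cobounded ℂ) := by
      refine ((tendsto_add_const_cobounded q).comp
        (tendsto_inv₀_nhdsNE_zero (α := ℂ))).congr fun w => ?_
      simp [add_comm]
    rw [Metric.cobounded_eq_cocompact, ← coclosedCompact_eq_cocompact] at h1
    have h2 := OnePoint.tendsto_coe_infty.comp h1
    have h3 : invertAt q 0 = OnePoint.infty := by simp [invertAt]
    rw [h3]
    refine h2.congr' ?_
    filter_upwards [self_mem_nhdsWithin] with w hw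
    have : w ≠ 0 := hw
    simp [invertAt, this]
  · have h1 : ContinuousAt (fun w : ℂ => ((q + w⁻¹ : ℂ) : OnePoint ℂ)) w :=
      OnePoint.continuous_coe.continuousAt.comp
        (continuousAt_const.add (continuousAt_inv₀ hw))
    refine h1.congr ?_
    filter_upwards [isOpen_ne.mem_nhds hw] with v hv
    have : v ≠ 0 := hv
    simp [invertAt, this]

/-- A function on the sphere cannot coincide with `crossRatio p q` on the frontier of an open set
containing `p` but not accumulating at `q` and be the exponential of a continuous function. -/
theorem not_exp_eq_crossRatio_on_frontier {U : Set (OnePoint ℂ)} {p q : ℂ}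
    (hp : (p : OnePoint ℂ) ∈ U) (hq : (q : OnePoint ℂ) ∉ closure U) {h : OnePoint ℂ → ℂ}
    (hh : Continuous h)
    (hfr : ∀ x ∈ frontier (closure U), Complex.exp (h x) = crossRatio p q x) : False := by
  classical
  have hpq : q - p ≠ 0 := by
    rw [sub_ne_zero]
    rintro rfl
    exact hq (subset_closure hp)
  -- Replacing the affine map by `exp ∘ h` over `closure U` removes its only zero, which lies over
  -- `p`. Near infinity nothing changes, because `q` is away from `closure U`.
  set G : ℂ → ℂ := fun w => if invertAt q w ∈ closure U then Complex.exp (h (invertAt q w))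
    else (q - p) * w + 1 with hGdef
  have hG : Continuous G := by
    refine Continuous.if ?_ (Complex.continuous_exp.comp (hh.comp (continuous_invertAt q)))
      (by fun_prop)
    intro w hw
    rw [← crossRatio_invertAt]
    exact hfr _ ((continuous_invertAt q).frontier_preimage_subset (closure U) hw)
  have hopen : IsOpen {z : ℂ | (z : OnePoint ℂ) ∉ closure U} :=
    (isClosed_closure.isOpen_compl).preimage OnePoint.continuous_coe
  obtain ⟨ε, hε, hball⟩ := Metric.isOpen_iff.1 hopen q hq
  obtain ⟨w, hw⟩ := exists_zero_of_affine_near_infinity hG hpq (R := 2 / ε) (by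
    intro w hw
    have hwpos : 0 < ‖w‖ := lt_of_lt_of_le (by positivity) hw
    have hw0 : w ≠ 0 := norm_pos_iff.1 hwpos
    have : (q + w⁻¹ : ℂ) ∈ Metric.ball q ε := by
      rw [Metric.mem_ball, dist_eq_norm, add_sub_cancel_left, norm_inv,
        inv_lt_comm₀ hwpos hε]
      refine lt_of_lt_of_le ?_ hw
      rw [inv_eq_one_div]
      gcongr
      norm_num
    have h2 := hball this
    simp only [Set.mem_ofPred_eq] at h2
    simp [hGdef, invertAt, hw0, h2])
  by_cases hm : invertAt q w ∈ closure U
  · simp [hGdef, hm] at hw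
  · simp only [hGdef, hm, if_false] at hw
    have hw0 : w ≠ 0 := by rintro rfl; simp at hw
    have hpw : q + w⁻¹ = p := by
      field_simp
      linear_combination hw
    apply hm
    simp only [invertAt, hw0, if_false, hpw]
    exact subset_closure hp

/-- A continuous function without zeros on the circle has a logarithm that is continuous away from
a given point. -/
theorem exists_log_on_circle {ψ : Circle → ℂ} (hψ : Continuous ψ) (h0 : ∀ x, ψ x ≠ 0)
    (c : Circle) : ∃ L : Circle → ℂ, ContinuousOn L {c}ᶜ ∧ ∀ x, Complex.exp (L x) = ψ x := by
  -- Angles are measured from `-c`, so that the branch cut of `arg` falls at `c`.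
  obtain ⟨F, hF, hFψ⟩ := exists_continuous_log (A := ℝ) (f := fun t => ψ (-c * Circle.exp t))
    (by fun_prop) fun t => h0 _
  refine ⟨fun x => F (Complex.arg ((-c⁻¹ * x : Circle) : ℂ)), ?_, ?_⟩
  · refine hF.comp_continuousOn fun x hx => ContinuousAt.continuousWithinAt ?_
    refine ContinuousAt.comp (f := fun x : Circle => ((-c⁻¹ * x : Circle) : ℂ))
      (g := Complex.arg) (Complex.continuousAt_arg ?_) (by fun_prop)
    rw [Complex.mem_slitPlane_iff_not_le_zero]
    intro hle
    apply hx
    have hn : ‖((-c⁻¹ * x : Circle) : ℂ)‖ = 1 := Circle.norm_coe _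
    rw [Complex.le_def] at hle
    have h1 : ((-c⁻¹ * x : Circle) : ℂ) = -1 := by
      have him : ((-c⁻¹ * x : Circle) : ℂ).im = 0 := by simpa using hle.2
      have hre : ((-c⁻¹ * x : Circle) : ℂ).re ≤ 0 := by simpa using hle.1
      have hsq := Complex.normSq_apply ((-c⁻¹ * x : Circle) : ℂ)
      rw [Complex.normSq_eq_norm_sq, hn, him] at hsq
      apply Complex.ext
      · simp only [Complex.neg_re, Complex.one_re]
        nlinarith
      · simpa using him
    have h2 : -c⁻¹ * x = -1 := by
      apply Circle.ext
      rw [h1]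
      simp
    have h3 : c⁻¹ * x = 1 := by simpa using h2
    exact (inv_mul_eq_one.1 h3).symm
  · intro x
    rw [hFψ, Circle.exp_arg]
    simp

/-! ### Components of the complement of a Jordan curve -/

/-- The components of the complement of a set through `∞` closed in the sphere are open. -/
theorem IsComponentOf.isOpen {U γ : Set (OnePoint ℂ)} (hγ : IsClosed γ)
    (hinf : OnePoint.infty ∈ γ) (hU : IsComponentOf U γᶜ) : IsOpen U := by
  obtain ⟨x, -, rfl⟩ := hU
  rw [isOpen_iff_mem_nhds]
  intro y hy
  have hyγ := connectedComponentIn_subset _ _ hy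
  rw [connectedComponentIn_eq hy]
  induction y using OnePoint.rec with
  | infty => exact absurd hinf hyγ
  | coe z =>
    have hopen : IsOpen {z : ℂ | (z : OnePoint ℂ) ∈ γᶜ} :=
      hγ.isOpen_compl.preimage OnePoint.continuous_coe
    obtain ⟨ε, hε, hball⟩ := Metric.isOpen_iff.1 hopen z hyγ
    refine Filter.mem_of_superset
      (OnePoint.isOpenEmbedding_coe.isOpenMap.image_mem_nhds (Metric.ball_mem_nhds z hε)) ?_
    refine IsPreconnected.subset_connectedComponentIn ?_
      ⟨z, Metric.mem_ball_self hε, rfl⟩ (Set.image_subset_iff.2 hball)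
    exact (convex_ball z ε).isPreconnected.image _ OnePoint.continuous_coe.continuousOn

theorem IsComponentOf.subset {U S : Set (OnePoint ℂ)} (hU : IsComponentOf U S) : U ⊆ S := by
  obtain ⟨x, -, rfl⟩ := hU
  exact connectedComponentIn_subset _ _

theorem IsComponentOf.nonempty {U S : Set (OnePoint ℂ)} (hU : IsComponentOf U S) :
    U.Nonempty := by
  obtain ⟨x, hx, rfl⟩ := hU
  exact ⟨x, mem_connectedComponentIn hx⟩

theorem IsComponentOf.eq_of_mem {U V S : Set (OnePoint ℂ)} (hU : IsComponentOf U S)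
    (hV : IsComponentOf V S) {y : OnePoint ℂ} (hyU : y ∈ U) (hyV : y ∈ V) : U = V := by
  obtain ⟨x, hx, rfl⟩ := hU
  obtain ⟨x', hx', rfl⟩ := hV
  rw [connectedComponentIn_eq hyU, connectedComponentIn_eq hyV]

/-- A component of the complement is relatively closed. -/
theorem IsComponentOf.closure_subset {U γ : Set (OnePoint ℂ)} (hγ : IsClosed γ)
    (hinf : OnePoint.infty ∈ γ) (hU : IsComponentOf U γᶜ) : closure U ⊆ U ∪ γ := by
  intro y hy
  by_cases hyγ : y ∈ γ
  · exact Or.inr hyγ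
  · left
    have hV : IsComponentOf (connectedComponentIn γᶜ y) γᶜ := ⟨y, hyγ, rfl⟩
    have hyV : y ∈ connectedComponentIn γᶜ y := mem_connectedComponentIn hyγ
    obtain ⟨z, hzV, hzU⟩ := mem_closure_iff.1 hy _ (hV.isOpen hγ hinf) hyV
    rwa [hU.eq_of_mem hV hzU hzV]

theorem IsJordanCurve.isClosed {γ : Set (OnePoint ℂ)} (hγ : IsJordanCurve γ) : IsClosed γ := by
  obtain ⟨f, hf, -, rfl⟩ := hγ
  exact (isCompact_range hf).isClosed

/-- If the complement of a Jordan curve is not connected, then every component of the complement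
accumulates on the whole curve. -/
theorem IsJordanCurve.subset_closure_component {γ U : Set (OnePoint ℂ)} (hγ : IsJordanCurve γ)
    (hinf : OnePoint.infty ∈ γ) (hU : IsComponentOf U γᶜ) (hne : (γᶜ \ U).Nonempty) :
    γ ⊆ closure U := by
  have hcl := hγ.isClosed
  intro s hs
  by_contra hsU
  obtain ⟨q', hqγ, hqU⟩ := hne
  obtain ⟨p', hpU⟩ := hU.nonempty
  have hpγ := hU.subset hpU
  induction p' using OnePoint.rec with
  | infty => exact hpγ hinf
  | coe p =>
  induction q' using OnePoint.rec with
  | infty => exact hqγ hinf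
  | coe q =>
  have hsub := hU.closure_subset hcl hinf
  obtain ⟨f, hf, hfi, rfl⟩ := hγ
  obtain ⟨c, rfl⟩ := hs
  have hfp : ∀ x, f x ≠ p := fun x h => hpγ ⟨x, h⟩
  have hfq : ∀ x, f x ≠ q := fun x h => hqγ ⟨x, h⟩
  obtain ⟨L, hL, hLexp⟩ := exists_log_on_circle (ψ := fun x => crossRatio p q (f x))
    (continuous_iff_continuousAt.2 fun x =>
      (continuousAt_crossRatio p (hfq x)).comp hf.continuousAt)
    (fun x => crossRatio_ne_zero (hfp x) (hfq x)) c
  set C : Set Circle := f ⁻¹' closure U with hC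
  have hCclosed : IsClosed C := isClosed_closure.preimage hf
  have : CompactSpace C := isCompact_iff_compactSpace.1 hCclosed.isCompact
  have hemb : IsClosedEmbedding (fun x : C => f x) :=
    (hf.comp continuous_subtype_val).isClosedEmbedding
      (hfi.comp Subtype.val_injective)
  -- `f c` is not in `closure U`, so `C` avoids the one possible discontinuity of `L`, and Tietze
  -- extends `L` from the curve to the sphere.
  have hLC : Continuous (fun x : C => L x) := by
    refine (hL.mono ?_).comp_continuous continuous_subtype_val fun x => x.2
    rintro x hx rfl
    exact hsU hx
  obtain ⟨h, hh⟩ := ContinuousMap.exists_extension' hemb ⟨_, hLC⟩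
  refine not_exp_eq_crossRatio_on_frontier hpU
    (fun hq => (hsub hq).elim hqU hqγ) h.continuous ?_
  intro x hx
  have hxU : x ∈ closure U := isClosed_closure.frontier_subset hx
  rcases hsub hxU with hxU' | ⟨y, rfl⟩
  · exfalso
    rw [frontier, Set.mem_sdiff] at hx
    exact hx.2 (interior_maximal subset_closure (hU.isOpen hcl hinf) hxU')
  · have := congrFun hh ⟨y, hxU⟩
    simp only [Function.comp_apply, ContinuousMap.coe_mk] at this
    rw [this, hLexp]

/-- There is no continuous injection of the circle into the line. -/
theorem not_injective_of_continuous_circle {φ : Circle → ℝ} (hφ : Continuous φ) :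
    ¬ Function.Injective φ := by
  intro hinj
  have : PreconnectedSpace Circle := by
    have := (Circle.exp).continuous
    have hs : Function.Surjective Circle.exp := fun x => ⟨Complex.arg x, Circle.exp_arg x⟩
    exact hs.denseRange.preconnectedSpace this
  -- This odd function has a zero, where `φ` takes equal values at antipodal points.
  have hcont : Continuous fun x : Circle => φ x - φ (-x) := by fun_prop
  have hmem : (0 : ℝ) ∈ Set.range fun x : Circle => φ x - φ (-x) := by
    refine (isPreconnected_range hcont).ordConnected.uIcc_subset ⟨1, rfl⟩ ⟨-1, rfl⟩ ?_
    rw [Set.mem_uIcc]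
    rcases le_total (φ 1) (φ (-1)) with h | h
    · left; constructor <;> simp <;> linarith
    · right; constructor <;> simp <;> linarith
  obtain ⟨x, hx⟩ := hmem
  have h1 : x = -x := hinj (sub_eq_zero.1 hx)
  have h2 : (x : ℂ) = -x := by
    conv_lhs => rw [h1]
    simp
  exact Circle.coe_ne_zero x (self_eq_neg.1 h2)

/-- A Jordan curve has empty interior. -/
theorem IsJordanCurve.not_subset_of_isOpen {γ W : Set (OnePoint ℂ)} (hγ : IsJordanCurve γ)
    (hW : IsOpen W) (hne : W.Nonempty) : ¬ W ⊆ γ := by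
  intro hsub
  obtain ⟨f, hf, hfi, rfl⟩ := hγ
  obtain ⟨_, hzW, z, rfl⟩ := OnePoint.denseRange_coe.inter_open_nonempty W hW hne
  obtain ⟨ε, hε, hball⟩ := Metric.isOpen_iff.1 (hW.preimage OnePoint.continuous_coe) z hzW
  obtain ⟨c, hc⟩ := hsub hzW
  have hmem : ∀ x : Circle, ((z + (ε / 2 : ℝ) * x : ℂ) : OnePoint ℂ) ∈ Set.range f := by
    intro x
    refine hsub (hball ?_)
    rw [Metric.mem_ball, dist_eq_norm]
    simp only [add_sub_cancel_left, norm_mul, Circle.norm_coe, Complex.norm_real, mul_one]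
    rw [Real.norm_of_nonneg (by positivity)]
    linarith
  choose u hu using hmem
  have hε2 : ((ε / 2 : ℝ) : ℂ) ≠ 0 := by
    exact_mod_cast (by positivity : ε / 2 ≠ 0)
  have hucont : Continuous u := by
    rw [(hf.isClosedEmbedding hfi).isInducing.continuous_iff]
    have : f ∘ u = fun x : Circle => ((z + (ε / 2 : ℝ) * x : ℂ) : OnePoint ℂ) := funext hu
    rw [this]
    exact OnePoint.continuous_coe.comp (by fun_prop)
  have huinj : Function.Injective u := by
    intro x y hxy
    have h1 := hu x
    rw [hxy, hu y, OnePoint.coe_eq_coe] at h1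
    exact (Circle.ext (mul_left_cancel₀ hε2 (add_left_cancel h1))).symm
  -- `f c` is the centre of the small circle parametrized by `f ∘ u`. So `u` embeds a circle into a
  -- circle minus a point, where the logarithm maps injectively to a line.
  have huc : ∀ x, u x ≠ c := by
    intro x hx
    have h1 := hu x
    rw [hx, hc, OnePoint.coe_eq_coe] at h1
    have h2 : ((ε / 2 : ℝ) : ℂ) * x = 0 := by linear_combination -h1
    exact (mul_ne_zero hε2 (Circle.coe_ne_zero x)) h2
  obtain ⟨L, hL, hLexp⟩ := exists_log_on_circle (ψ := fun x => (x : ℂ)) (by fun_prop)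
    Circle.coe_ne_zero c
  have hLim : ∀ x, L x = (L x).im * Complex.I := by
    intro x
    have h1 : Real.exp (L x).re = 1 := by
      rw [← Complex.norm_exp, hLexp, Circle.norm_coe]
    rw [Real.exp_eq_one_iff] at h1
    apply Complex.ext <;> simp [h1]
  refine not_injective_of_continuous_circle (φ := fun x => (L (u x)).im)
    (Complex.continuous_im.comp (hL.comp_continuous hucont huc)) fun x y hxy => huinj ?_
  apply Circle.ext
  rw [← hLexp, ← hLexp, hLim (u x), hLim (u y)]
  simp only at hxy
  rw [hxy]

/-! ### Closures of the exteriors -/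

namespace AreIndependent

variable {n : ℕ} {γ I : Fin n → Set (OnePoint ℂ)}

theorem isOpen_interior (h : AreIndependent γ I) (hinf : ∀ k, OnePoint.infty ∈ γ k) (k : Fin n) :
    IsOpen (I k) :=
  (h.component k).isOpen (h.jordan k).isClosed (hinf k)

/-- As `n ≥ 2`, there is another interior; it is open, hence not swallowed by `γ k`, and it is
disjoint from `I k`. -/
theorem exteriorPart_nonempty (h : AreIndependent γ I) (hinf : ∀ k, OnePoint.infty ∈ γ k)
    (k : Fin n) : (exteriorPart (γ k) (I k)).Nonempty := by
  have := Fin.nontrivial_iff_two_le.2 h.two_le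
  obtain ⟨j, hj⟩ := exists_ne k
  obtain ⟨x, hxI, hxγ⟩ := Set.not_subset.1 ((h.jordan k).not_subset_of_isOpen
    (h.isOpen_interior hinf j) (h.component j).nonempty)
  exact ⟨x, hxγ, Set.disjoint_left.1 (h.disjoint j k hj) hxI⟩

/-- Every point of `γ k` is a limit of `I k`, so an open `I j` containing it would meet `I k`. -/
theorem disjoint_curve_interior (h : AreIndependent γ I) (hinf : ∀ k, OnePoint.infty ∈ γ k)
    (k j : Fin n) : Disjoint (γ k) (I j) := by
  rw [Set.disjoint_left]
  intro x hxγ hxI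
  rcases eq_or_ne j k with rfl | hjk
  · exact (h.component j).subset hxI hxγ
  · have hx := (h.jordan k).subset_closure_component (hinf k) (h.component k)
      (h.exteriorPart_nonempty hinf k) hxγ
    obtain ⟨y, hyj, hyk⟩ := mem_closure_iff.1 hx _ (h.isOpen_interior hinf j) hxI
    exact Set.disjoint_left.1 (h.disjoint j k hjk) hyj hyk

/-- The exterior contains a whole component of the complement of `γ k`, and this component already
accumulates on all of `γ k`. -/
theorem closure_exteriorPart (h : AreIndependent γ I) (hinf : ∀ k, OnePoint.infty ∈ γ k)
    (k : Fin n) : closure (exteriorPart (γ k) (I k)) = (I k)ᶜ := by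
  refine Set.Subset.antisymm
    (closure_minimal (fun x hx => hx.2) (h.isOpen_interior hinf k).isClosed_compl) fun x hx => ?_
  by_cases hxγ : x ∈ γ k
  · obtain ⟨y, hyγ, hyI⟩ := h.exteriorPart_nonempty hinf k
    have hV : IsComponentOf (connectedComponentIn (γ k)ᶜ y) (γ k)ᶜ := ⟨y, hyγ, rfl⟩
    have hVI : ∀ z ∈ connectedComponentIn (γ k)ᶜ y, z ∉ I k := fun z hz hzI =>
      hyI ((h.component k).eq_of_mem hV hzI hz ▸ mem_connectedComponentIn hyγ)
    obtain ⟨z, hz⟩ := (h.component k).nonempty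
    have hVE : connectedComponentIn (γ k)ᶜ y ⊆ exteriorPart (γ k) (I k) :=
      fun w hw => ⟨hV.subset hw, hVI w hw⟩
    exact closure_mono hVE ((h.jordan k).subset_closure_component (hinf k) hV
        ⟨z, (h.component k).subset hz, fun hzV => hVI z hzV hz⟩ hxγ)
  · exact subset_closure ⟨hxγ, hx⟩

theorem isClosed_curve_union_interior (h : AreIndependent γ I)
    (hinf : ∀ k, OnePoint.infty ∈ γ k) (k : Fin n) : IsClosed (γ k ∪ I k) := by
  refine isClosed_of_closure_subset ?_
  rw [closure_union, (h.jordan k).isClosed.closure_eq]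
  refine Set.union_subset Set.subset_union_left ?_
  rw [Set.union_comm]
  exact (h.component k).closure_subset (h.jordan k).isClosed (hinf k)

/-- A point that lies on exactly one of the curves is accumulated by the common exterior. -/
theorem mem_closure_commonExterior (h : AreIndependent γ I)
    (hinf : ∀ k, OnePoint.infty ∈ γ k) {k : Fin n} {x : OnePoint ℂ} (hx : x ∈ γ k)
    (hxj : ∀ j ≠ k, x ∉ γ j) : x ∈ closure (commonExterior γ I) := by
  have hdis := h.disjoint_curve_interior hinf
  -- On this neighbourhood of `x` the common exterior coincides with the exterior of `γ k`.
  have hO : IsOpen (⋂ j : {j // j ≠ k}, (γ j ∪ I j)ᶜ) :=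
    isOpen_iInter_of_finite fun j => (h.isClosed_curve_union_interior hinf j).isOpen_compl
  have hxO : x ∈ ⋂ j : {j // j ≠ k}, (γ j ∪ I j)ᶜ := by
    simp only [Set.mem_iInter, Set.mem_compl_iff, Set.mem_union, not_or]
    exact fun j => ⟨hxj j j.2, Set.disjoint_left.1 (hdis k j) hx⟩
  have hxE : x ∈ closure (exteriorPart (γ k) (I k)) := by
    rw [h.closure_exteriorPart hinf]
    exact Set.disjoint_left.1 (hdis k k) hx
  refine closure_mono ?_ (hO.inter_closure ⟨hxO, hxE⟩)
  rintro y ⟨hyO, hyE⟩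
  refine Set.mem_iInter.2 fun j => ?_
  rcases eq_or_ne j k with rfl | hjk
  · exact hyE
  · have := Set.mem_iInter.1 hyO ⟨j, hjk⟩
    simpa only [exteriorPart, Set.mem_sdiff, Set.mem_compl_iff, Set.mem_union, not_or] using this

/-- Only finitely many points of `γ k` lie on other curves. The circle has no isolated points, so
the remaining points are dense in `γ k`. -/
theorem closure_commonExterior (h : AreIndependent γ I) (hinf : ∀ k, OnePoint.infty ∈ γ k) :
    closure (commonExterior γ I) = (⋃ k, I k)ᶜ := by
  refine Set.Subset.antisymm (closure_minimal ?_
    (isOpen_iUnion (h.isOpen_interior hinf)).isClosed_compl) fun x hx => ?_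
  · rintro x hx hxI
    obtain ⟨k, hk⟩ := Set.mem_iUnion.1 hxI
    exact (Set.mem_iInter.1 hx k).2 hk
  · by_cases hxγ : ∃ k, x ∈ γ k
    · obtain ⟨k, hk⟩ := hxγ
      set B : Set (OnePoint ℂ) := ⋃ j : {j // j ≠ k}, γ k ∩ γ j with hB
      have hBfin : B.Finite := Set.finite_iUnion fun j => h.finite_inter k j j.2.symm
      have hacc : γ k \ B ⊆ closure (commonExterior γ I) := fun y hy =>
        h.mem_closure_commonExterior hinf hy.1 fun j hj hyj =>
          hy.2 (Set.mem_iUnion.2 ⟨⟨j, hj⟩, hy.1, hyj⟩)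
      refine closure_minimal hacc isClosed_closure ?_
      obtain ⟨f, hf, hfi, hfr⟩ := h.jordan k
      rw [← hfr] at hk ⊢
      obtain ⟨c, rfl⟩ := hk
      have : ConnectedSpace Circle :=
        Function.Surjective.connectedSpace (f := Circle.exp)
          (fun x => ⟨Complex.arg x, Circle.exp_arg x⟩) Circle.exp.continuous
      have : Nontrivial Circle := ⟨⟨1, -1, fun h1 => by
        have h2 : ((1 : Circle) : ℂ) = ((-1 : Circle) : ℂ) := congrArg _ h1
        norm_num at h2⟩⟩
      have hdense : Dense (f ⁻¹' B)ᶜ := by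
        simpa [Set.compl_eq_univ_sdiff] using
          dense_univ.sdiff_finite (hBfin.preimage hfi.injOn)
      refine closure_mono ?_ (image_closure_subset_closure_image hf ⟨c, hdense c, rfl⟩)
      rintro _ ⟨y, hy, rfl⟩
      exact ⟨⟨y, rfl⟩, hy⟩
    · push Not at hxγ
      refine subset_closure (Set.mem_iInter.2 fun k => ⟨hxγ k, fun hk => hx ?_⟩)
      exact Set.mem_iUnion.2 ⟨k, hk⟩

end AreIndependent

/-! ### Counting finite fixed points by degree -/

theorem Polynomial.eval_inv_eq_eval_reverse_div {K : Type*} [Field K] (p : Polynomial K) {w : K}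
    (hw : w ≠ 0) : p.eval w⁻¹ = p.reverse.eval w / w ^ p.natDegree := by
  have := invertibleOfNonzero (inv_ne_zero hw)
  have h := Polynomial.eval₂_reverse_mul_pow (RingHom.id K) w⁻¹ p
  rw [invOf_eq_inv, inv_inv] at h
  rw [Polynomial.eval, ← h, inv_pow, div_eq_mul_inv]
  rfl

/-- Near `∞` the map `g` is `w ↦ w ^ (k + 1) * u w` with `u` given by the reversed polynomials. -/
theorem chartAtInfty_eq (g : RatFunc ℂ) {k : ℕ}
    (hk : g.num.natDegree = g.denom.natDegree + k + 1) (w : ℂ) :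
    chartAtInfty g w = w * (w ^ k * (g.denom.reverse.eval w / g.num.reverse.eval w)) := by
  by_cases hw : w = 0
  · simp [chartAtInfty, hw]
  · simp only [chartAtInfty, hw, if_false]
    rw [g.num.eval_inv_eq_eval_reverse_div hw, g.denom.eval_inv_eq_eval_reverse_div hw, hk]
    by_cases hN : g.num.reverse.eval w = 0
    · simp [hN]
    by_cases hD : g.denom.reverse.eval w = 0
    · simp [hD]
    field_simp
    ring

/-- The degree count behind the holomorphic fixed point formula: at a repelling fixed point `∞` the
map has exactly one more finite fixed point than finite poles. -/
theorem IsRepellingAtInfty.natDegree_fixed {g : RatFunc ℂ} (hg : IsRepellingAtInfty g) :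
    (g.num - Polynomial.X * g.denom).natDegree = g.denom.natDegree + 1 := by
  obtain ⟨hfix, μ, hμ, hμ1⟩ := hg
  have hlt : g.denom.natDegree < g.num.natDegree := by
    by_contra hle
    simp [sphereMap, hle] at hfix
  obtain ⟨k, hk⟩ := Nat.exists_eq_add_of_lt hlt
  have hD0 : g.denom ≠ 0 := g.denom_ne_zero
  have hN0 : g.num ≠ 0 := by
    intro h
    simp [h] at hlt
  have hrev : g.num.reverse.eval 0 ≠ 0 := by
    rw [← Polynomial.coeff_zero_eq_eval_zero, Polynomial.coeff_zero_reverse]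
    exact Polynomial.leadingCoeff_ne_zero.2 hN0
  have hdiff : DifferentiableAt ℂ
      (fun w => w ^ k * (g.denom.reverse.eval w / g.num.reverse.eval w)) 0 := by
    refine (differentiableAt_id.pow k).mul (DifferentiableAt.div ?_ ?_ hrev) <;>
      exact Polynomial.differentiableAt _
  have hder := (hasDerivAt_id (0 : ℂ)).mul hdiff.hasDerivAt
  have hfun : chartAtInfty g =
      id * fun w => w ^ k * (g.denom.reverse.eval w / g.num.reverse.eval w) :=
    funext (chartAtInfty_eq g hk)
  rw [← hfun] at hder
  have hval := hμ.unique hder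
  simp only [id, zero_mul, add_zero, one_mul] at hval
  -- For `k > 0` the multiplier would be `0`.
  have hk0 : k = 0 := by
    by_contra hk0
    rw [hval, zero_pow hk0] at hμ1
    norm_num at hμ1
  subst hk0
  rw [pow_zero, one_mul, ← Polynomial.coeff_zero_eq_eval_zero,
    ← Polynomial.coeff_zero_eq_eval_zero, Polynomial.coeff_zero_reverse,
    Polynomial.coeff_zero_reverse] at hval
  refine Polynomial.natDegree_eq_of_le_of_coeff_ne_zero ?_ ?_
  · refine (Polynomial.natDegree_sub_le _ _).trans (max_le hk.le ?_)
    rw [Polynomial.natDegree_X_mul hD0]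
  -- The top coefficient is the difference of the leading coefficients of `P` and `Q`; if it
  -- vanished, the multiplier would be `1`.
  · rw [Polynomial.coeff_sub, Polynomial.coeff_X_mul, sub_ne_zero]
    intro heq
    have h1 : g.num.leadingCoeff = g.denom.leadingCoeff := by
      rw [Polynomial.leadingCoeff, hk]
      exact heq
    rw [hval, h1, div_self (Polynomial.leadingCoeff_ne_zero.2 hD0)] at hμ1
    norm_num at hμ1

theorem Polynomial.sum_rootMultiplicity_roots {K : Type*} [Field K] [IsAlgClosed K]
    [DecidableEq K] (p : Polynomial K) :
    ∑ z ∈ p.roots.toFinset, p.rootMultiplicity z = p.natDegree := by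
  rw [← IsAlgClosed.card_roots_eq_natDegree, ← Multiset.toFinset_sum_count_eq]
  simp only [Polynomial.count_roots]

theorem sphereMap_eq_self_of_isRoot (g : RatFunc ℂ) {z : ℂ}
    (hz : (g.num - Polynomial.X * g.denom).IsRoot z) :
    sphereMap g (z : OnePoint ℂ) = (z : OnePoint ℂ) := by
  have h1 : g.num.eval z = z * g.denom.eval z := by
    simpa [sub_eq_zero] using hz
  have h2 : g.denom.eval z ≠ 0 := by
    intro h0
    obtain ⟨a, b, hab⟩ := g.isCoprime_num_denom
    have := congrArg (Polynomial.eval z) hab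
    simp [h1, h0] at this
  simp [sphereMap, h2, h1]

/-! ### Summing the counts over the curves -/

open scoped Classical in
/-- Summation over disjoint sets, pointwise. -/
theorem sum_ite_mem_of_disjoint {α ι M : Type*} [Fintype ι] [AddCommMonoid M] {I : ι → Set α}
    (hI : ∀ i j, i ≠ j → Disjoint (I i) (I j)) (x : α) (c : M) :
    ∑ k, (if x ∈ I k then c else 0) = if x ∈ ⋃ k, I k then c else 0 := by
  by_cases hx : x ∈ ⋃ k, I k
  · rw [if_pos hx]
    obtain ⟨k, hk⟩ := Set.mem_iUnion.1 hx
    rw [Finset.sum_eq_single k, if_pos hk]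
    · exact fun j _ hj => if_neg fun hxj => Set.disjoint_left.1 (hI j k hj) hxj hk
    · simp
  · rw [if_neg hx]
    exact Finset.sum_eq_zero fun k _ => if_neg fun hk => hx (Set.mem_iUnion.2 ⟨k, hk⟩)

open scoped Classical in
/-- The share of the order of `p` as a pole of `g` on the interior side of a curve `γ`, when the
share of the exterior side is `m p`; it vanishes off the curve. -/
noncomputable def interiorShare (g : RatFunc ℂ) (γ : Set (OnePoint ℂ)) (m : ℂ → ℕ) (p : ℂ) : ℤ :=
  if (p : OnePoint ℂ) ∈ γ then (poleOrder g p : ℤ) - m p else 0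

theorem exteriorMult_eq (g : RatFunc ℂ) (γ : Set (OnePoint ℂ)) (m : ℂ → ℕ) (p : ℂ) :
    (exteriorMult g γ m p : ℤ) = poleOrder g p - interiorShare g γ m p := by
  unfold exteriorMult interiorShare
  split_ifs <;> simp

theorem commonMult_eq (g : RatFunc ℂ) {n : ℕ} (γ : Fin n → Set (OnePoint ℂ)) (m : Fin n → ℂ → ℕ)
    (p : ℂ) : commonMult g γ m p = poleOrder g p - ∑ k, interiorShare g (γ k) (m k) p := by
  unfold commonMult interiorShare
  rw [Finset.sum_filter]

-- Each fixed point lies in exactly one interior, so it is counted for the other `n - 1` indices.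
open scoped Classical in
theorem sum_fixedCount_compl_interiors {g : RatFunc ℂ} {n : ℕ} {γ I : Fin n → Set (OnePoint ℂ)}
    (h : AreIndependent γ I)
    (hfix : ∀ z : ℂ, sphereMap g (z : OnePoint ℂ) = (z : OnePoint ℂ) →
      (z : OnePoint ℂ) ∈ ⋃ k, I k) :
    ∑ k, (fixedCount g (I k)ᶜ : ℤ) =
      (n - 1) * ((g.num - Polynomial.X * g.denom).natDegree : ℤ) := by
  set R := g.num - Polynomial.X * g.denom with hR
  have htot : ∑ z ∈ R.roots.toFinset, (R.rootMultiplicity z : ℤ) = R.natDegree := by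
    exact_mod_cast R.sum_rootMultiplicity_roots
  have hk : ∀ k, (fixedCount g (I k)ᶜ : ℤ) = R.natDegree - ∑ z ∈ R.roots.toFinset,
      if (z : OnePoint ℂ) ∈ I k then (R.rootMultiplicity z : ℤ) else 0 := by
    intro k
    rw [← htot, ← Finset.sum_sub_distrib, fixedCount, Finset.sum_filter, ← hR]
    push_cast
    refine Finset.sum_congr rfl fun z _ => ?_
    by_cases hz : (z : OnePoint ℂ) ∈ I k <;> simp [hz]
  have hall : ∑ k, ∑ z ∈ R.roots.toFinset,
      (if (z : OnePoint ℂ) ∈ I k then (R.rootMultiplicity z : ℤ) else 0) = R.natDegree := by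
    rw [Finset.sum_comm, ← htot]
    refine Finset.sum_congr rfl fun z hz => ?_
    rw [sum_ite_mem_of_disjoint h.disjoint, if_pos]
    refine hfix z (sphereMap_eq_self_of_isRoot g ?_)
    exact Polynomial.isRoot_of_mem_roots (Multiset.mem_toFinset.1 hz)
  rw [Finset.sum_congr rfl fun k _ => hk k, Finset.sum_sub_distrib, hall]
  simp
  ring

open scoped Classical in
theorem sum_commonMult_eq {g : RatFunc ℂ} (hg : IsRepellingAtInfty g) {n : ℕ}
    {γ I : Fin n → Set (OnePoint ℂ)} (h : AreIndependent γ I)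
    (hinf : ∀ k, OnePoint.infty ∈ γ k)
    (hfix : ∀ z : ℂ, sphereMap g (z : OnePoint ℂ) = (z : OnePoint ℂ) →
      (z : OnePoint ℂ) ∈ ⋃ k, I k) (m : Fin n → ℂ → ℕ)
    (hcount : ∀ k, ∑ p ∈ polesIn g (closure (exteriorPart (γ k) (I k))),
      exteriorMult g (γ k) (m k) p = fixedCount g (closure (exteriorPart (γ k) (I k)))) :
    ∑ p ∈ polesIn g (closure (commonExterior γ I)), commonMult g γ m p = (n : ℤ) - 1 := by
  set T := g.denom.roots.toFinset with hT
  have htot : ∑ p ∈ T, (poleOrder g p : ℤ) = g.denom.natDegree := by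
    exact_mod_cast g.denom.sum_rootMultiplicity_roots
  have hshare : ∀ j k, ∀ p : ℂ, (p : OnePoint ℂ) ∈ I j → interiorShare g (γ k) (m k) p = 0 :=
    fun j k p hp => if_neg fun hpγ =>
      Set.disjoint_left.1 (h.disjoint_curve_interior hinf k j) hpγ hp
  set S : Fin n → ℤ := fun k => ∑ p ∈ T,
    ((if (p : OnePoint ℂ) ∈ I k then (poleOrder g p : ℤ) else 0) +
      interiorShare g (γ k) (m k) p) with hS
  have hk : ∀ k, (g.denom.natDegree : ℤ) - S k = fixedCount g (I k)ᶜ := by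
    intro k
    rw [← h.closure_exteriorPart hinf, ← hcount k, h.closure_exteriorPart hinf, ← htot,
      ← Finset.sum_sub_distrib, polesIn, Finset.sum_filter]
    push_cast
    refine Finset.sum_congr rfl fun p _ => ?_
    by_cases hp : (p : OnePoint ℂ) ∈ I k
    · simp [hp, hshare k k p hp]
    · simp [hp, exteriorMult_eq]
  have hsum : ∑ k, ((g.denom.natDegree : ℤ) - S k) =
      (n - 1) * ((g.denom.natDegree : ℤ) + 1) := by
    rw [Finset.sum_congr rfl fun k _ => hk k, sum_fixedCount_compl_interiors h hfix,
      hg.natDegree_fixed]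
    push_cast
    rfl
  rw [Finset.sum_sub_distrib, Finset.sum_const, Finset.card_univ, Fintype.card_fin,
    nsmul_eq_mul] at hsum
  have hgoal : ∑ p ∈ polesIn g (closure (commonExterior γ I)), commonMult g γ m p =
      g.denom.natDegree - ∑ k, S k := by
    rw [h.closure_commonExterior hinf, Finset.sum_comm, ← htot, ← Finset.sum_sub_distrib,
      polesIn, Finset.sum_filter]
    refine Finset.sum_congr rfl fun p _ => ?_
    rw [Finset.sum_add_distrib, sum_ite_mem_of_disjoint h.disjoint, commonMult_eq]
    by_cases hp : (p : OnePoint ℂ) ∈ ⋃ k, I k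
    · obtain ⟨j, hj⟩ := Set.mem_iUnion.1 hp
      simp only [Set.mem_compl_iff, hp, not_true_eq_false, if_false, if_true,
        Finset.sum_congr rfl fun k _ => hshare j k p hj]
      simp
    · rw [if_pos (show (p : OnePoint ℂ) ∈ (⋃ k, I k)ᶜ from hp), if_neg hp, zero_add]
  rw [hgoal]
  linear_combination hsum

theorem proposition3p4 (g : RatFunc ℂ) (hg : IsRepellingAtInfty g) (n : ℕ)
    (γ I : Fin n → Set (OnePoint ℂ)) (hγ : AreIndependent γ I)
    (hinf : ∀ k, OnePoint.infty ∈ γ k)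
    (hfix : ∀ z : ℂ, sphereMap g (z : OnePoint ℂ) = (z : OnePoint ℂ) →
      (z : OnePoint ℂ) ∈ ⋃ k, I k) :
    -- poles on the curves are counted with their full order
    ((∀ k, poleCount g (closure (exteriorPart (γ k) (I k))) =
        fixedCount g (closure (exteriorPart (γ k) (I k)))) →
      poleCount g (closure (commonExterior γ I)) = n - 1) ∧
    -- poles on the curves are counted only with a share of their order on each side
    (∀ m : Fin n → ℂ → ℕ,
      (∀ k, ∀ p ∈ polesIn g (γ k), 1 ≤ m k p ∧ m k p ≤ poleOrder g p) →
      (∀ k, ∑ p ∈ polesIn g (closure (exteriorPart (γ k) (I k))), exteriorMult g (γ k) (m k) p =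
        fixedCount g (closure (exteriorPart (γ k) (I k)))) →
      ∑ p ∈ polesIn g (closure (commonExterior γ I)), commonMult g γ m p = (n : ℤ) - 1) := by
  have hshared := fun m => sum_commonMult_eq hg hγ hinf hfix m
  refine ⟨fun hcount => ?_, fun m _ => hshared m⟩
  have hext : ∀ k p, exteriorMult g (γ k) (poleOrder g) p = poleOrder g p := by
    simp [exteriorMult]
  have hcommon : ∀ p, commonMult g γ (fun _ => poleOrder g) p = poleOrder g p := by
    simp [commonMult]
  -- Full order is the case in which every interior share is zero.
  have hfull := hshared (fun _ => poleOrder g) fun k =>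
    (Finset.sum_congr rfl fun p _ => hext k p).trans (hcount k)
  rw [Finset.sum_congr rfl fun p _ => hcommon p] at hfull
  have htwo := hγ.two_le
  have hcast : (poleCount g (closure (commonExterior γ I)) : ℤ) = (n : ℤ) - 1 := by
    rw [← hfull, poleCount]
    push_cast
    rfl
  omega
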